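/- Let $d\ge 1$. For a potential $W:\mathbb{R}^d\to\mathbb{R}\cup\{\infty\}$ that is locally integrable, bounded from below, lower semicontinuous and even, set $$E[\rho]=\frac12\int_{\mathbb{R}^d}\int_{\mathbb{R}^d}W(\mathbf{x}-\mathbf{y})\,\mathrm{d}\rho(\mathbf{y})\,\mathrm{d}\rho(\mathbf{x})\in\mathbb{R}\cup\{\infty\}$$ for Borel probability measures $\rho$ on $\mathbb{R}^d$; a minimizer for $W$ is a probability measure that minimizes $E$ among all probability measures. Call $W$ admissible if, moreover, $W_\infty:=\lim_{|\mathbf{x}|\to\infty}W(\mathbf{x})$ exists in $\mathbb{R}\cup\{\infty\}$ and $E[\rho]<\frac12 W_\infty$ for some probability measure $\rho$. A number $R_*\in(0,\infty)$ is called an upper bound of minimizer size for $W$ if $W$ is admissible, every minimizer for $W$ is compactly supported, and every minimizer $\rho$ for $W$ with $\int_{\mathbb{R}^d}\mathbf{x}\,\mathrm{d}\rho(\mathbf{x})=0$ satisfies $\operatorname{supp}\rho\subset\overline{B(0;R_*)}$. For real numbers $-d<b<a$ let $$W_{a,b}(\mathbf{x})=\frac{|\mathbf{x}|^a}{a}-\frac{|\mathbf{x}|^b}{b},$$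 where $\frac{|\mathbf{x}|^0}{0}$ is understood as $\ln|\mathbf{x}|$ and $W_{a,b}(0)=\lim_{\mathbf{x}\to0}W_{a,b}(\mathbf{x})\in\mathbb{R}\cup\{\infty\}$. **Theorem.** For every $b>-d$ and every $a_0>\max\{b,0\}$ there exists $R_*=R_*(b,a_0)\in(0,\infty)$ (which may also depend on the dimension $d$, but not on $a$) that is an upper bound of minimizer size for $W_{a,b}$ for all $a\ge a_0$ simultaneously. -/

import Mathlib

open MeasureTheory Filter Topology

noncomputable section

/-- The interaction energy `E[ρ] = ½ ∫∫ W(x - y) dρ(y) dρ(x)` with values in the extended reals: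
the integral of the positive part minus the integral of the negative part. For `W` bounded from
below and a probability measure `ρ` the second integral is finite, so the value is in `ℝ ∪ {∞}`. -/
def interactionEnergy {d : ℕ} (W : EuclideanSpace ℝ (Fin d) → EReal)
    (ρ : ProbabilityMeasure (EuclideanSpace ℝ (Fin d))) : EReal :=
  ((1 / 2 : ℝ) : EReal) *
    (((∫⁻ x, ∫⁻ y, (W (x - y)).toENNReal ∂(ρ : Measure (EuclideanSpace ℝ (Fin d)))
        ∂(ρ : Measure (EuclideanSpace ℝ (Fin d))) : ENNReal) : EReal) -
      ((∫⁻ x, ∫⁻ y, (-W (x - y)).toENNReal ∂(ρ : Measure (EuclideanSpace ℝ (Fin d)))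
        ∂(ρ : Measure (EuclideanSpace ℝ (Fin d))) : ENNReal) : EReal))

/-- `ρ` minimizes the interaction energy of `W` among all probability measures on `ℝ^d`. -/
def IsEnergyMinimizer {d : ℕ} (W : EuclideanSpace ℝ (Fin d) → EReal)
    (ρ : ProbabilityMeasure (EuclideanSpace ℝ (Fin d))) : Prop :=
  ∀ ρ' : ProbabilityMeasure (EuclideanSpace ℝ (Fin d)),
    interactionEnergy W ρ ≤ interactionEnergy W ρ'

/-- The basic assumption on an interaction potential `W : ℝ^d → ℝ ∪ {∞}`: locally integrable,
bounded from below, lower semicontinuous and even. -/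
structure BasicAssumption {d : ℕ} (W : EuclideanSpace ℝ (Fin d) → EReal) : Prop where
  locallyIntegrable : ∀ K : Set (EuclideanSpace ℝ (Fin d)), IsCompact K →
    ∫⁻ x in K, (W x).abs ∂volume < ⊤
  boundedBelow : ∃ m : ℝ, ∀ x, (m : EReal) ≤ W x
  lowerSemicontinuous : LowerSemicontinuous W
  even : ∀ x, W (-x) = W x

/-- The standing assumptions on an interaction potential: the basic assumption, existence of the
limit `W∞ ∈ ℝ ∪ {∞}` of `W` at infinity, and a probability measure of energy below `½ W∞`. -/
structure IsAdmissiblePotential {d : ℕ} (W : EuclideanSpace ℝ (Fin d) → EReal) : Prop where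
  basic : BasicAssumption W
  limit : ∃ Winf : EReal, Winf ≠ ⊥ ∧ Tendsto W (cocompact (EuclideanSpace ℝ (Fin d))) (𝓝 Winf) ∧
    ∃ ρ : ProbabilityMeasure (EuclideanSpace ℝ (Fin d)),
      interactionEnergy W ρ < ((1 / 2 : ℝ) : EReal) * Winf

/-- `R ∈ (0, ∞)` is an upper bound of minimizer size for the admissible potential `W`. -/
structure IsUpperBoundOfMinimizerSize {d : ℕ} (W : EuclideanSpace ℝ (Fin d) → EReal)
    (R : ℝ) : Prop where
  admissible : IsAdmissiblePotential W
  pos : 0 < R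
  compactSupport : ∀ ρ : ProbabilityMeasure (EuclideanSpace ℝ (Fin d)),
    IsEnergyMinimizer W ρ → IsCompact (ρ : Measure (EuclideanSpace ℝ (Fin d))).support
  support_subset : ∀ ρ : ProbabilityMeasure (EuclideanSpace ℝ (Fin d)),
    IsEnergyMinimizer W ρ → ∫ x, x ∂(ρ : Measure (EuclideanSpace ℝ (Fin d))) = 0 →
      (ρ : Measure (EuclideanSpace ℝ (Fin d))).support ⊆ Metric.closedBall 0 R

/-- The function `t ^ c / c` of `t > 0`, understood as `log t` when `c = 0`. -/
def powerTerm (c t : ℝ) : ℝ :=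
  if c = 0 then Real.log t else t ^ c / c

/-- The power-law potential `|x|^a / a - |x|^b / b` for `b < a`, with its limit as value at the
origin, which is `∞` for `b ≤ 0` (and `0` for `b > 0`). -/
def powerLawPotential (d : ℕ) (a b : ℝ) (x : EuclideanSpace ℝ (Fin d)) : EReal :=
  open Classical in
  if x = 0 ∧ b ≤ 0 then ⊤ else ((powerTerm a ‖x‖ - powerTerm b ‖x‖ : ℝ) : EReal)

end

/-!
By the Euler–Lagrange condition, the potential `∫ W (x - y) dρ(y)` of a minimizer `ρ` takes the
constant value `2 E[ρ]` at `ρ`-almost every `x`. If `W` is bounded below and is large compared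
with `E[ρ]` outside a ball of radius `L` around the origin, Markov's inequality then forces
`ρ (closedBall x L) > 1 / 2` for almost every `x`. Two such balls must meet, so almost every pair of
points lies within distance `2 L`, and a centred minimizer lives in the ball of radius `2 L`.

The bound is uniform in `a ≥ a₀` because `(t ^ c - 1) / c` increases with `c`, which gives
`W_{a₀,b} - 1 / a₀ ≤ W_{a,b}` everywhere, while `t ^ c / c` decreases with `c > 0` for `t ≤ 1`, so
that `W_{a,b} ≤ W_{a₀,b}` on the unit ball, which controls the minimal energy from above.
-/

open scoped ENNReal NNReal Pointwise ProbabilityTheory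

/-- The interaction `∫∫ K x y dν(y) dμ(x)` of two measures through a nonnegative kernel `K`. On the
diagonal `μ = ν` it is, up to a factor and an additive constant, the interaction energy; the
off-diagonal values express its first variation. -/
noncomputable def kernelForm {X : Type*} [MeasurableSpace X] (K : X → X → ℝ≥0∞)
    (μ ν : Measure X) : ℝ≥0∞ :=
  ∫⁻ x, ∫⁻ y, K x y ∂ν ∂μ

section kernelForm

variable {X : Type*} [MeasurableSpace X] {K K' : X → X → ℝ≥0∞} {μ ν : Measure X}

lemma kernelForm_mono_measure {μ' ν' : Measure X} (hμ : μ ≤ μ') (hν : ν ≤ ν') :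
    kernelForm K μ ν ≤ kernelForm K μ' ν' :=
  lintegral_mono' hμ fun _ => lintegral_mono' hν le_rfl

lemma kernelForm_mono_of_ae_le (h : ∀ᵐ x ∂μ, ∀ᵐ y ∂ν, K x y ≤ K' x y) :
    kernelForm K μ ν ≤ kernelForm K' μ ν :=
  lintegral_mono_ae <| h.mono fun _ hx => lintegral_mono_ae hx

lemma kernelForm_const (c : ℝ≥0∞) [IsProbabilityMeasure μ] [IsProbabilityMeasure ν] :
    kernelForm (fun _ _ => c) μ ν = c := by
  simp [kernelForm]

lemma kernelForm_add_kernel [SFinite ν] (hK : Measurable (Function.uncurry K)) :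
    kernelForm (fun x y => K x y + K' x y) μ ν = kernelForm K μ ν + kernelForm K' μ ν := by
  simp only [kernelForm, lintegral_add_left hK.of_uncurry_left,
    lintegral_add_left hK.lintegral_prod_right]

lemma kernelForm_smul_left (c : ℝ≥0∞) : kernelForm K (c • μ) ν = c * kernelForm K μ ν :=
  lintegral_smul_measure _ _

lemma kernelForm_smul_right [SFinite ν] (hK : Measurable (Function.uncurry K)) (c : ℝ≥0∞) :
    kernelForm K μ (c • ν) = c * kernelForm K μ ν := by
  simp only [kernelForm, lintegral_smul_measure, smul_eq_mul,
    lintegral_const_mul _ hK.lintegral_prod_right]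

lemma kernelForm_add_left (μ' : Measure X) :
    kernelForm K (μ + μ') ν = kernelForm K μ ν + kernelForm K μ' ν :=
  lintegral_add_measure _ _ _

lemma kernelForm_add_right [SFinite ν] (hK : Measurable (Function.uncurry K)) (ν' : Measure X) :
    kernelForm K μ (ν + ν') = kernelForm K μ ν + kernelForm K μ ν' := by
  simp only [kernelForm, lintegral_add_measure, lintegral_add_left hK.lintegral_prod_right]

lemma kernelForm_comm [SFinite μ] [SFinite ν] (hK : Measurable (Function.uncurry K))
    (hsymm : ∀ x y, K x y = K y x) : kernelForm K μ ν = kernelForm K ν μ := by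
  unfold kernelForm
  rw [lintegral_lintegral_swap hK.aemeasurable]
  simp_rw [hsymm]

lemma kernelForm_smul_add_smul_self [SFinite μ] [SFinite ν]
    (hK : Measurable (Function.uncurry K)) (hsymm : ∀ x y, K x y = K y x) (s t : ℝ≥0∞) :
    kernelForm K (s • μ + t • ν) (s • μ + t • ν) =
      s ^ 2 * kernelForm K μ μ + 2 * (s * t) * kernelForm K ν μ + t ^ 2 * kernelForm K ν ν := by
  simp only [kernelForm_add_left, kernelForm_smul_left, kernelForm_add_right hK,
    kernelForm_smul_right hK, kernelForm_comm (μ := μ) (ν := ν) hK hsymm]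
  ring

end kernelForm

lemma le_of_forall_le_convexCombination_sq {I A Y : ℝ}
    (h : ∀ t ∈ Set.Ioo (0 : ℝ) 1, I ≤ (1 - t) ^ 2 * I + 2 * ((1 - t) * t) * A + t ^ 2 * Y) :
    I ≤ A := by
  have hquot : ∀ᶠ t in 𝓝[>] (0 : ℝ), (2 - t) * I ≤ 2 * (1 - t) * A + t * Y := by
    filter_upwards [Ioo_mem_nhdsGT one_pos] with t ht
    refine le_of_mul_le_mul_left ?_ ht.1
    linarith [h t ht]
  have hlim (f : ℝ → ℝ) (hf : Continuous f) : Tendsto f (𝓝[>] 0) (𝓝 (f 0)) :=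
    hf.continuousAt.continuousWithinAt
  have := le_of_tendsto_of_tendsto (hlim _ (by fun_prop)) (hlim _ (by fun_prop)) hquot
  linarith

section EulerLagrange

variable {X : Type*} [MeasurableSpace X] {K : X → X → ℝ≥0∞} {ρ : Measure X}
  [IsProbabilityMeasure ρ]

lemma kernelForm_self_le_of_forall_le (hK : Measurable (Function.uncurry K))
    (hsymm : ∀ x y, K x y = K y x)
    (hmin : ∀ σ : Measure X, IsProbabilityMeasure σ → kernelForm K ρ ρ ≤ kernelForm K σ σ)
    (hfin : kernelForm K ρ ρ ≠ ∞) {ν : Measure X} [IsProbabilityMeasure ν]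
    (hν : kernelForm K ν ν ≠ ∞) : kernelForm K ρ ρ ≤ kernelForm K ν ρ := by
  rcases eq_or_ne (kernelForm K ν ρ) ∞ with htop | hne
  · exact htop ▸ le_top
  rw [← ENNReal.toReal_le_toReal hfin hne]
  refine le_of_forall_le_convexCombination_sq (Y := (kernelForm K ν ν).toReal)
    fun t ⟨ht₀, ht₁⟩ => ?_
  have hs₀ : 0 ≤ 1 - t := sub_nonneg.2 ht₁.le
  have hprob : IsProbabilityMeasure (ENNReal.ofReal (1 - t) • ρ + ENNReal.ofReal t • ν) :=
    ⟨by simp [← ENNReal.ofReal_add hs₀ ht₀.le]⟩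
  have hle := ENNReal.toReal_mono (by rw [kernelForm_smul_add_smul_self hK hsymm]; finiteness)
    (hmin _ hprob)
  rw [kernelForm_smul_add_smul_self hK hsymm, ENNReal.toReal_add (by finiteness) (by finiteness),
    ENNReal.toReal_add (by finiteness) (by finiteness)] at hle
  simpa [ENNReal.toReal_ofReal hs₀, ENNReal.toReal_ofReal ht₀.le] using hle

lemma kernelForm_cond_self_ne_top (hK : Measurable (Function.uncurry K))
    (hfin : kernelForm K ρ ρ ≠ ∞) {s : Set X} (hs : ρ s ≠ 0) :
    kernelForm K ρ[|s] ρ[|s] ≠ ∞ := by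
  have hle : ρ[|s] ≤ (ρ s)⁻¹ • ρ := by
    unfold ProbabilityTheory.cond
    gcongr
    exact Measure.restrict_le_self
  refine ne_top_of_le_ne_top ?_ (kernelForm_mono_measure hle hle)
  rw [kernelForm_smul_left, kernelForm_smul_right hK]
  finiteness

theorem ae_lintegral_eq_kernelForm_of_forall_le (hK : Measurable (Function.uncurry K))
    (hsymm : ∀ x y, K x y = K y x)
    (hmin : ∀ σ : Measure X, IsProbabilityMeasure σ → kernelForm K ρ ρ ≤ kernelForm K σ σ)
    (hfin : kernelForm K ρ ρ ≠ ∞) :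
    ∀ᵐ x ∂ρ, ∫⁻ y, K x y ∂ρ = kernelForm K ρ ρ := by
  have hV : Measurable fun x => ∫⁻ y, K x y ∂ρ := hK.lintegral_prod_right
  have hge : ∀ᵐ x ∂ρ, kernelForm K ρ ρ ≤ ∫⁻ y, K x y ∂ρ := by
    refine ae_le_of_forall_setLIntegral_le_of_sigmaFinite measurable_const fun s _ _ => ?_
    rw [setLIntegral_const]
    rcases eq_or_ne (ρ s) 0 with hs | hs
    · simp [hs]
    have := ProbabilityTheory.cond_isProbabilityMeasure hs
    have hle := kernelForm_self_le_of_forall_le hK hsymm hmin hfin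
      (kernelForm_cond_self_ne_top hK hfin hs)
    rwa [ProbabilityTheory.cond, kernelForm_smul_left, mul_comm, ← div_eq_mul_inv,
      ENNReal.le_div_iff_mul_le (.inl hs) (.inl (measure_ne_top ρ s))] at hle
  exact (ae_eq_of_ae_le_of_lintegral_le hge (by simpa using hfin) hV.aemeasurable
    (by simp [kernelForm])).symm

end EulerLagrange

section Concentration

open Metric

lemma half_lt_measure_closedBall_of_lintegral_le {X : Type*} [PseudoMetricSpace X]
    [MeasurableSpace X] [OpensMeasurableSpace X] {ρ : Measure X} [IsProbabilityMeasure ρ]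
    {f : X → ℝ≥0∞} {C G : ℝ≥0∞} {L : ℝ} {x : X} (hG : 2 * C < G)
    (hfar : ∀ y, L < dist y x → G ≤ f y) (hf : ∫⁻ y, f y ∂ρ ≤ C) :
    1 / 2 < ρ (closedBall x L) := by
  have hmarkov : G * ρ (closedBall x L)ᶜ ≤ C :=
    calc G * ρ (closedBall x L)ᶜ
      _ = ∫⁻ _ in (closedBall x L)ᶜ, G ∂ρ := (setLIntegral_const _ _).symm
      _ ≤ ∫⁻ y in (closedBall x L)ᶜ, f y ∂ρ :=
        setLIntegral_mono' measurableSet_closedBall.compl fun y hy => hfar y (by simpa using hy)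
      _ ≤ C := (setLIntegral_le_lintegral _ _).trans hf
  by_contra! hball
  have hcompl : 1 / 2 ≤ ρ (closedBall x L)ᶜ := by
    rw [prob_compl_eq_one_sub measurableSet_closedBall]
    exact ENNReal.le_sub_of_add_le_right (hball.trans_lt (by simp)).ne
      ((add_le_add_right hball _).trans_eq (ENNReal.add_halves 1))
  refine hG.not_ge ?_
  calc G = 2 * (G * (1 / 2)) := by
        rw [mul_left_comm, one_div, ENNReal.mul_inv_cancel two_ne_zero ENNReal.ofNat_ne_top,
          mul_one]
    _ ≤ 2 * C := by gcongr; exact (mul_le_mul_right hcompl G).trans hmarkov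

lemma dist_le_two_mul_of_half_lt_measure_closedBall {X : Type*} [PseudoMetricSpace X]
    [MeasurableSpace X] [OpensMeasurableSpace X] {ρ : Measure X} [IsProbabilityMeasure ρ] {L : ℝ}
    {x y : X} (hx : 1 / 2 < ρ (closedBall x L)) (hy : 1 / 2 < ρ (closedBall y L)) :
    dist x y ≤ 2 * L := by
  obtain ⟨z, hzx, hzy⟩ := nonempty_inter_of_measure_lt_add ρ measurableSet_closedBall
    (Set.subset_univ (closedBall x L)) (Set.subset_univ (closedBall y L))
    (by simpa only [measure_univ, ENNReal.add_halves] using ENNReal.add_lt_add hx hy)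
  linarith [dist_triangle_left x y z, mem_closedBall.1 hzx, mem_closedBall.1 hzy]

lemma support_subset_closedBall_integral {E : Type*} [NormedAddCommGroup E] [NormedSpace ℝ E]
    [CompleteSpace E] [SecondCountableTopology E] [MeasurableSpace E] [BorelSpace E]
    {ρ : Measure E} [IsProbabilityMeasure ρ] {D : ℝ} (hD : ∀ᵐ x ∂ρ, ∀ᵐ y ∂ρ, dist x y ≤ D) :
    ρ.support ⊆ closedBall (∫ y, y ∂ρ) D := by
  obtain ⟨c, hc⟩ := hD.exists
  have hint : Integrable (fun y : E => y) ρ :=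
    .of_bound aestronglyMeasurable_id (‖c‖ + D) <| hc.mono fun y hy =>
      (norm_le_norm_add_norm_sub c y).trans (by gcongr; rwa [← dist_eq_norm])
  refine Measure.support_subset_of_isClosed isClosed_closedBall (hD.mono fun x hx => ?_)
  exact mem_closedBall_comm.1 <| (convex_closedBall x D).integral_mem isClosed_closedBall
    (hx.mono fun y hy => mem_closedBall'.2 hy) hint

end Concentration

section Energy

variable {d : ℕ} {W W' : EuclideanSpace ℝ (Fin d) → EReal} {M : ℝ≥0}
  {ρ : ProbabilityMeasure (EuclideanSpace ℝ (Fin d))}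

/-- The kernel `W (x - y) + M`. It is meant for potentials `W ≥ -M`, so that the truncation at `0`
in its definition is harmless; the energies of `W` and of its shift differ by the constant `M / 2`,
and the shift has no negative part to keep track of. -/
noncomputable def shiftedKernel (W : EuclideanSpace ℝ (Fin d) → EReal) (M : ℝ≥0)
    (x y : EuclideanSpace ℝ (Fin d)) : ℝ≥0∞ :=
  (W (x - y) + (M : ℝ)).toENNReal

lemma measurable_shiftedKernel (hW : Measurable W) :
    Measurable (Function.uncurry (shiftedKernel W M)) :=
  ((hW.comp measurable_sub).add measurable_const).ereal_toENNReal

lemma shiftedKernel_comm (heven : ∀ x, W (-x) = W x) (x y : EuclideanSpace ℝ (Fin d)) :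
    shiftedKernel W M x y = shiftedKernel W M y x := by
  rw [shiftedKernel, shiftedKernel, ← heven, neg_sub]

lemma toENNReal_add_coe_add_toENNReal_neg {w : EReal} (hw : -((M : ℝ) : EReal) ≤ w) :
    (w + (M : ℝ)).toENNReal + (-w).toENNReal = w.toENNReal + M := by
  induction w with
  | bot => simp [← EReal.coe_neg] at hw
  | top => simp
  | coe r =>
    have hr : -(M : ℝ) ≤ r := by exact_mod_cast hw
    rw [← EReal.coe_add, ← EReal.coe_neg, ← ENNReal.ofReal_coe_nnreal (p := M)]
    simp only [EReal.real_coe_toENNReal]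
    rcases le_total 0 r with h | h
    · rw [ENNReal.ofReal_of_nonpos (neg_nonpos.2 h), add_zero, ENNReal.ofReal_add h M.coe_nonneg]
    · rw [ENNReal.ofReal_of_nonpos h, zero_add, ← ENNReal.ofReal_add (by linarith) (by linarith)]
      ring_nf

lemma kernelForm_toENNReal_neg_ne_top (hM : ∀ x, -((M : ℝ) : EReal) ≤ W x) :
    kernelForm (fun x y => (-W (x - y)).toENNReal) (ρ : Measure _) ρ ≠ ∞ := by
  have hle (z) : (-W z).toENNReal ≤ M := by
    rw [← EReal.toENNReal_coe (x := M)]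
    exact EReal.toENNReal_le_toENNReal (EReal.neg_le.1 (hM z))
  refine ne_top_of_le_ne_top ENNReal.coe_ne_top <|
    (kernelForm_mono_of_ae_le (K' := fun _ _ => (M : ℝ≥0∞)) ?_).trans_eq (kernelForm_const _)
  exact .of_forall fun x => .of_forall fun y => hle _

lemma coe_kernelForm_shiftedKernel (hW : Measurable W) (hM : ∀ x, -((M : ℝ) : EReal) ≤ W x) :
    ((kernelForm (shiftedKernel W M) (ρ : Measure _) ρ : ℝ≥0∞) : EReal) =
      ((2 : ℝ) : EReal) * interactionEnergy W ρ + (M : ℝ) := by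
  set μ := (ρ : Measure (EuclideanSpace ℝ (Fin d)))
  set P := kernelForm (fun x y => (W (x - y)).toENNReal) μ μ with hP
  set N := kernelForm (fun x y => (-W (x - y)).toENNReal) μ μ with hN
  have hN_top : N ≠ ∞ := kernelForm_toENNReal_neg_ne_top hM
  have hsum : kernelForm (shiftedKernel W M) μ μ + N = P + M := by
    rw [hN, hP, ← kernelForm_const (μ := μ) (ν := μ) (M : ℝ≥0∞),
      ← kernelForm_add_kernel (measurable_shiftedKernel hW),
      ← kernelForm_add_kernel (hW.comp measurable_sub).ereal_toENNReal]
    simp only [shiftedKernel, toENNReal_add_coe_add_toENNReal_neg (hM _)]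
  have henergy : ((2 : ℝ) : EReal) * interactionEnergy W ρ = (P : EReal) - N := by
    change ((2 : ℝ) : EReal) * (((1 / 2 : ℝ) : EReal) * ((P : EReal) - N)) = _
    rw [← mul_assoc, ← EReal.coe_mul, mul_one_div_cancel two_ne_zero, EReal.coe_one, one_mul]
  calc (kernelForm (shiftedKernel W M) μ μ : EReal)
      = (kernelForm (shiftedKernel W M) μ μ + N : ℝ≥0∞) - N := by
        rw [EReal.coe_ennreal_add, ← EReal.coe_ennreal_toReal hN_top, EReal.add_sub_cancel_right]
    _ = P + (M : ℝ) - N := by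
        rw [hsum, EReal.coe_ennreal_add, ← EReal.coe_ennreal_toReal ENNReal.coe_ne_top,
          ENNReal.coe_toReal]
    _ = ((2 : ℝ) : EReal) * interactionEnergy W ρ + (M : ℝ) := by
        rw [henergy]
        simp only [sub_eq_add_neg, add_right_comm]

lemma kernelForm_shiftedKernel_le_of_interactionEnergy_le (hW : Measurable W)
    (hM : ∀ x, -((M : ℝ) : EReal) ≤ W x) {ρ' : ProbabilityMeasure (EuclideanSpace ℝ (Fin d))}
    (h : interactionEnergy W ρ ≤ interactionEnergy W ρ') :
    kernelForm (shiftedKernel W M) ρ ρ ≤ kernelForm (shiftedKernel W M) ρ' ρ' := by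
  rw [← EReal.coe_ennreal_le_coe_ennreal_iff, coe_kernelForm_shiftedKernel hW hM,
    coe_kernelForm_shiftedKernel hW hM]
  gcongr

lemma coe_kernelForm_shiftedKernel_le (hW : Measurable W)
    (hM : ∀ x, -((M : ℝ) : EReal) ≤ W x) {e : ℝ} (he : interactionEnergy W ρ ≤ e) :
    ((kernelForm (shiftedKernel W M) (ρ : Measure _) ρ : ℝ≥0∞) : EReal) ≤ (2 * e + M : ℝ) := by
  rw [coe_kernelForm_shiftedKernel hW hM, EReal.coe_add, EReal.coe_mul]
  gcongr

lemma interactionEnergy_mono_of_ae_le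
    (h : ∀ᵐ x ∂(ρ : Measure (EuclideanSpace ℝ (Fin d))),
      ∀ᵐ y ∂(ρ : Measure (EuclideanSpace ℝ (Fin d))), W (x - y) ≤ W' (x - y)) :
    interactionEnergy W ρ ≤ interactionEnergy W' ρ := by
  refine mul_le_mul_of_nonneg_left (EReal.sub_le_sub ?_ ?_) (EReal.coe_nonneg.2 one_half_pos.le) <;>
    refine EReal.coe_ennreal_le_coe_ennreal_iff.2 (kernelForm_mono_of_ae_le ?_)
  · exact h.mono fun x hx => hx.mono fun y hy => EReal.toENNReal_le_toENNReal hy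
  · exact h.mono fun x hx => hx.mono fun y hy =>
      EReal.toENNReal_le_toENNReal (EReal.neg_le_neg_iff.2 hy)

lemma interactionEnergy_lt_top
    (h : kernelForm (fun x y => (W (x - y)).toENNReal)
      (ρ : Measure _) ρ ≠ ∞) : interactionEnergy W ρ < ⊤ := by
  set P := kernelForm (fun x y => (W (x - y)).toENNReal)
    (ρ : Measure _) ρ
  calc interactionEnergy W ρ ≤ ((1 / 2 : ℝ) : EReal) * (P : EReal) :=
        mul_le_mul_of_nonneg_left
          ((EReal.sub_le_sub le_rfl (EReal.coe_ennreal_nonneg _)).trans_eq (sub_zero _))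
          (EReal.coe_nonneg.2 one_half_pos.le)
    _ < ⊤ := by
        rw [← EReal.coe_ennreal_toReal h, ← EReal.coe_mul]
        exact EReal.coe_lt_top _

lemma IsEnergyMinimizer.ae_ae_dist_le (hρ : IsEnergyMinimizer W ρ) (hW : BasicAssumption W)
    (hM : ∀ x, -((M : ℝ) : EReal) ≤ W x) {e g L : ℝ} (he : interactionEnergy W ρ ≤ e)
    (hg : 4 * e + M < g) (hfar : ∀ x, L < ‖x‖ → g ≤ W x) :
    ∀ᵐ x ∂(ρ : Measure (EuclideanSpace ℝ (Fin d))),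
      ∀ᵐ y ∂(ρ : Measure (EuclideanSpace ℝ (Fin d))), dist x y ≤ 2 * L := by
  have hmeas : Measurable W := hW.lowerSemicontinuous.measurable
  have henergy := coe_kernelForm_shiftedKernel_le hmeas hM he
  have hI : kernelForm (shiftedKernel W M) ρ ρ ≤ ENNReal.ofReal (2 * e + M) := by
    simpa only [EReal.toENNReal_coe, EReal.real_coe_toENNReal] using
      EReal.toENNReal_le_toENNReal henergy
  have hEL := ae_lintegral_eq_kernelForm_of_forall_le (measurable_shiftedKernel (M := M) hmeas)
    (shiftedKernel_comm hW.even) (fun σ hσ =>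
      kernelForm_shiftedKernel_le_of_interactionEnergy_le hmeas hM (hρ ⟨σ, hσ⟩))
    (ne_top_of_le_ne_top ENNReal.ofReal_ne_top hI)
  have hG : 2 * ENNReal.ofReal (2 * e + M) < ENNReal.ofReal (g + M) := by
    have : 0 ≤ 2 * e + M := EReal.coe_nonneg.1 ((EReal.coe_ennreal_nonneg _).trans henergy)
    rw [← ENNReal.ofReal_ofNat 2, ← ENNReal.ofReal_mul zero_le_two]
    exact (ENNReal.ofReal_lt_ofReal_iff (by linarith)).2 (by linarith)
  have hhalf : ∀ᵐ x ∂(ρ : Measure (EuclideanSpace ℝ (Fin d))),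
      1 / 2 < (ρ : Measure _) (Metric.closedBall x L) := by
    filter_upwards [hEL] with x hx
    refine half_lt_measure_closedBall_of_lintegral_le hG (fun y hy => ?_) (hx.trans_le hI)
    rw [← EReal.real_coe_toENNReal, EReal.coe_add]
    refine EReal.toENNReal_le_toENNReal ?_
    gcongr
    exact hfar _ (by rwa [← dist_eq_norm, dist_comm])
  filter_upwards [hhalf] with x hx
  filter_upwards [hhalf] with y hy
  exact dist_le_two_mul_of_half_lt_measure_closedBall hx hy

end Energy

section UniformBound

open Metric

lemma kernelForm_sub_cond_le {G : Type*} [AddGroup G] [MeasurableSpace G] [MeasurableAdd G]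
    [MeasurableNeg G] {μ : Measure G} [μ.IsAddLeftInvariant] [μ.IsNegInvariant] (k : G → ℝ≥0∞)
    {s : Set G} (hs : MeasurableSet s) :
    kernelForm (fun x y => k (x - y)) μ[|s] μ[|s] ≤ (μ s)⁻¹ * ∫⁻ z in s - s, k z ∂μ := by
  have hinner (x) (hx : x ∈ s) : ∫⁻ y in s, k (x - y) ∂μ ≤ ∫⁻ z in s - s, k z ∂μ :=
    calc ∫⁻ y in s, k (x - y) ∂μ
      _ ≤ ∫⁻ y in s, (s - s).indicator k (x - y) ∂μ := setLIntegral_mono' hs fun y hy => by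
          rw [Set.indicator_of_mem (Set.sub_mem_sub hx hy)]
      _ ≤ ∫⁻ y, (s - s).indicator k (x - y) ∂μ := setLIntegral_le_lintegral _ _
      _ = ∫⁻ z, (s - s).indicator k z ∂μ := lintegral_sub_left_eq_self _ x
      _ ≤ ∫⁻ z in s - s, k z ∂μ := lintegral_indicator_le _ _
  calc kernelForm (fun x y => k (x - y)) μ[|s] μ[|s]
    _ ≤ ∫⁻ _, (μ s)⁻¹ * ∫⁻ z in s - s, k z ∂μ ∂μ[|s] := by
        refine lintegral_mono_ae ?_
        filter_upwards [ProbabilityTheory.ae_cond_mem hs] with x hx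
        rw [ProbabilityTheory.cond, lintegral_smul_measure, smul_eq_mul]
        exact mul_le_mul_right (hinner x hx) _
    _ ≤ (μ s)⁻¹ * ∫⁻ z in s - s, k z ∂μ := by
        rw [lintegral_const]
        exact mul_le_of_le_one_right' prob_le_one

lemma toENNReal_le_abs (w : EReal) : w.toENNReal ≤ w.abs := by
  induction w with
  | bot => simp
  | top => simp
  | coe r => exact ENNReal.ofReal_le_ofReal (le_abs_self r)

variable {d : ℕ} {W₀ W : EuclideanSpace ℝ (Fin d) → EReal}

lemma BasicAssumption.exists_interactionEnergy_lt_top (hW : BasicAssumption W) {r : ℝ}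
    (hr : 0 < r) :
    ∃ ρ : ProbabilityMeasure (EuclideanSpace ℝ (Fin d)), interactionEnergy W ρ < ⊤ ∧
      ∀ᵐ x ∂(ρ : Measure (EuclideanSpace ℝ (Fin d))),
        ∀ᵐ y ∂(ρ : Measure (EuclideanSpace ℝ (Fin d))), x - y ∈ ball 0 r := by
  set s : Set (EuclideanSpace ℝ (Fin d)) := ball 0 (r / 2)
  have hss : s - s = ball 0 r := by
    rw [ball_sub_ball (half_pos hr) (half_pos hr), sub_zero, add_halves]
  have hs : volume s ≠ 0 := (measure_ball_pos _ _ (half_pos hr)).ne'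
  have hmem : ∀ᵐ x ∂volume[|s], x ∈ s := ProbabilityTheory.ae_cond_mem measurableSet_ball
  refine ⟨⟨volume[|s],
    ProbabilityTheory.cond_isProbabilityMeasure_of_finite hs measure_ball_lt_top.ne⟩,
    interactionEnergy_lt_top ?_,
    hmem.mono fun x hx => hmem.mono fun y hy => hss ▸ Set.sub_mem_sub hx hy⟩
  refine ne_top_of_le_ne_top (ENNReal.mul_ne_top (ENNReal.inv_ne_top.2 hs) ?_)
    (kernelForm_sub_cond_le (fun z => (W z).toENNReal) measurableSet_ball)
  rw [hss]
  refine ne_top_of_le_ne_top (hW.locallyIntegrable _ (isCompact_closedBall 0 r)).ne ?_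
  exact lintegral_mono' (Measure.restrict_mono ball_subset_closedBall le_rfl)
    fun z => toENNReal_le_abs _

lemma BasicAssumption.isAdmissiblePotential (hW : BasicAssumption W)
    (hlim : Tendsto W (cocompact _) (𝓝 ⊤)) : IsAdmissiblePotential W where
  basic := hW
  limit := by
    obtain ⟨ρ, hρ, -⟩ := hW.exists_interactionEnergy_lt_top one_pos
    exact ⟨⊤, top_ne_bot, hlim, ρ, by rwa [EReal.coe_mul_top_of_pos one_half_pos]⟩

/-- The lower bound on `W` makes large distances expensive, uniformly in `W`, while the upper bound
near the origin makes one fixed test measure cheap. -/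
theorem BasicAssumption.exists_forall_isUpperBoundOfMinimizerSize (hW₀ : BasicAssumption W₀)
    (hlim : Tendsto W₀ (cocompact _) (𝓝 ⊤)) {r : ℝ} (hr : 0 < r) (c : ℝ) :
    ∃ R : ℝ, ∀ W : EuclideanSpace ℝ (Fin d) → EReal, BasicAssumption W →
      (∀ x, W₀ x - c ≤ W x) → (∀ x ∈ ball 0 r, W x ≤ W₀ x) →
        IsUpperBoundOfMinimizerSize W R := by
  obtain ⟨ρ₀, hρ₀, hclose⟩ := hW₀.exists_interactionEnergy_lt_top hr
  obtain ⟨m, hm⟩ := hW₀.boundedBelow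
  set e := (interactionEnergy W₀ ρ₀).toReal
  set M : ℝ≥0 := (c - m).toNNReal
  set g := 4 * e + M + 1
  obtain ⟨L, hL⟩ : ∃ L : ℝ, ∀ x, L < ‖x‖ → ((g + c : ℝ) : EReal) < W₀ x := by
    have hfar := hlim.eventually (lt_mem_nhds (EReal.coe_lt_top (g + c)))
    rw [← cobounded_eq_cocompact] at hfar
    obtain ⟨L, -, hL⟩ := (hasBasis_cobounded_compl_closedBall 0).eventually_iff.1 hfar
    exact ⟨L, fun x hx => hL (by simpa using hx)⟩
  refine ⟨2 * max L 1, fun W hW hlow hup => ?_⟩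
  have hshift (u : ℝ) (x) (hx : ((u + c : ℝ) : EReal) < W₀ x) : u ≤ W x := by
    refine le_trans ?_ ((EReal.sub_le_sub hx.le le_rfl).trans (hlow x))
    rw [← EReal.coe_sub, add_sub_cancel_right]
  have hM (x) : -((M : ℝ) : EReal) ≤ W x := by
    refine le_trans ?_ ((EReal.sub_le_sub (hm x) le_rfl).trans (hlow x))
    rw [← EReal.coe_neg, ← EReal.coe_sub, EReal.coe_le_coe_iff]
    linarith [Real.le_coe_toNNReal (c - m)]
  have hWlim : Tendsto W (cocompact _) (𝓝 ⊤) := EReal.tendsto_nhds_top_iff_real.2 fun u =>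
    (hlim.eventually (lt_mem_nhds (EReal.coe_lt_top (u + 1 + c)))).mono fun x hx =>
      (EReal.coe_lt_coe_iff.2 (lt_add_one u)).trans_le (hshift _ x hx)
  have hWfar (x) (hx : max L 1 < ‖x‖) : g ≤ W x :=
    hshift g x (hL x ((le_max_left L 1).trans_lt hx))
  have hdist (ρ) (hρ : IsEnergyMinimizer W ρ) := hρ.ae_ae_dist_le hW hM
    (((hρ ρ₀).trans (interactionEnergy_mono_of_ae_le
      (hclose.mono fun x hx => hx.mono fun y hy => hup _ hy))).trans
        (EReal.le_coe_toReal hρ₀.ne)) (lt_add_one _) hWfar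
  refine ⟨hW.isAdmissiblePotential hWlim, by positivity, fun ρ hρ => ?_, fun ρ hρ hmean => ?_⟩
  · exact (isCompact_closedBall _ _).of_isClosed_subset Measure.isClosed_support
      (support_subset_closedBall_integral (hdist ρ hρ))
  · exact hmean ▸ support_subset_closedBall_integral (hdist ρ hρ)

end UniformBound

section PowerTerm

variable {a b c t : ℝ}

lemma powerTerm_zero_left : powerTerm 0 = Real.log :=
  funext fun _ => if_pos rfl

lemma powerTerm_of_ne_zero (hc : c ≠ 0) : powerTerm c = fun t => t ^ c / c :=
  funext fun _ => if_neg hc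

lemma powerTerm_zero_right (hc : 0 < c) : powerTerm c 0 = 0 := by
  simp [powerTerm_of_ne_zero hc.ne', Real.zero_rpow hc.ne']

lemma continuousAt_powerTerm (h : t ≠ 0 ∨ 0 < c) : ContinuousAt (powerTerm c) t := by
  rcases eq_or_ne c 0 with rfl | hc
  · rw [powerTerm_zero_left]
    exact Real.continuousAt_log (h.resolve_right (lt_irrefl 0))
  · rw [powerTerm_of_ne_zero hc]
    exact (Real.continuousAt_rpow_const _ _ (h.imp_right le_of_lt)).div_const _

lemma tendsto_powerTerm_nhdsGT_zero_of_pos (hc : 0 < c) :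
    Tendsto (powerTerm c) (𝓝[>] 0) (𝓝 0) := by
  simpa only [powerTerm_zero_right hc] using
    (continuousAt_powerTerm (t := 0) (.inr hc)).tendsto.mono_left nhdsWithin_le_nhds

lemma tendsto_powerTerm_nhdsGT_zero_of_nonpos (hc : c ≤ 0) :
    Tendsto (powerTerm c) (𝓝[>] 0) atBot := by
  rcases hc.eq_or_lt with rfl | hc
  · simpa only [powerTerm_zero_left] using Real.tendsto_log_nhdsGT_zero
  · rw [powerTerm_of_ne_zero hc.ne]
    exact (tendsto_rpow_neg_nhdsGT_zero hc).atTop_div_const_of_neg hc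

-- `powerTerm c t - c⁻¹` is the slope `(t ^ c - 1) / c` of the convex map `c ↦ t ^ c` between `0`
-- and `c`; its limit at `c = 0` is `log t`, in agreement with the convention `0⁻¹ = 0`.
lemma powerTerm_sub_inv_le_powerTerm_sub_inv (ht : 0 < t) (hba : b ≤ a) :
    powerTerm b t - b⁻¹ ≤ powerTerm a t - a⁻¹ := by
  have hne {c : ℝ} (hc : c ≠ 0) : powerTerm c t - c⁻¹ = (t ^ c - 1) / c := by
    rw [powerTerm_of_ne_zero hc, sub_div, one_div]
  have hlog (c : ℝ) : c * Real.log t ≤ t ^ c - 1 := by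
    rw [← Real.log_rpow ht]
    exact Real.log_le_sub_one_of_pos (Real.rpow_pos_of_pos ht c)
  rcases eq_or_ne b 0 with rfl | hb <;> rcases eq_or_ne a 0 with rfl | ha
  · exact le_rfl
  · rw [hne ha, powerTerm_zero_left, inv_zero, sub_zero, le_div_iff₀' (hba.lt_of_ne' ha)]
    exact hlog a
  · rw [hne hb, powerTerm_zero_left, inv_zero, sub_zero, div_le_iff_of_neg' (hba.lt_of_ne hb)]
    exact hlog b
  · rw [hne hb, hne ha]
    simpa only [Real.rpow_zero, sub_zero] using (convexOn_rpow_left ht).secant_mono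
      (Set.mem_univ 0) (Set.mem_univ b) (Set.mem_univ a) hb ha hba

lemma powerTerm_le_powerTerm_of_le_one (hc : 0 < c) (hca : c ≤ a) (ht : 0 ≤ t) (ht' : t ≤ 1) :
    powerTerm a t ≤ powerTerm c t := by
  rw [powerTerm_of_ne_zero hc.ne', powerTerm_of_ne_zero (hc.trans_le hca).ne']
  exact div_le_div₀ (Real.rpow_nonneg ht c) (Real.rpow_le_rpow_of_exponent_ge' ht ht' hc.le hca)
    hc hca

lemma tendsto_powerTerm_sub_powerTerm_atTop (ha : 0 < a) (hba : b < a) :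
    Tendsto (fun t => powerTerm a t - powerTerm b t) atTop atTop := by
  obtain ⟨c, hbc, hca⟩ := exists_between (max_lt hba ha)
  have hc : 0 < c := (le_max_right b 0).trans_lt hbc
  have hlim : Tendsto (fun t : ℝ => t ^ c * (t ^ (a - c) / a - c⁻¹) + (c⁻¹ - b⁻¹)) atTop atTop :=
    tendsto_atTop_add_const_right _ _ <| (tendsto_rpow_atTop hc).atTop_mul_atTop₀ <|
      tendsto_atTop_add_const_right _ _ <| (tendsto_rpow_atTop (sub_pos.2 hca)).atTop_div_const ha
  refine tendsto_atTop_mono' _ ?_ hlim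
  filter_upwards [eventually_gt_atTop 0] with t ht
  have hsplit : t ^ c * (t ^ (a - c) / a - c⁻¹) = powerTerm a t - powerTerm c t := by
    rw [powerTerm_of_ne_zero ha.ne', powerTerm_of_ne_zero hc.ne', mul_sub, ← mul_div_assoc,
      ← Real.rpow_add ht, add_sub_cancel, ← div_eq_mul_inv]
  have hmono := powerTerm_sub_inv_le_powerTerm_sub_inv ht ((le_max_left b 0).trans hbc.le)
  linarith

lemma integrableOn_powerTerm_norm {E : Type*} [NormedAddCommGroup E] [NormedSpace ℝ E]
    [Nontrivial E] [FiniteDimensional ℝ E] [MeasurableSpace E] [BorelSpace E] (μ : Measure E)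
    [μ.IsAddHaarMeasure] (hc : -(Module.finrank ℝ E : ℝ) < c) (r : ℝ) :
    IntegrableOn (fun x : E => powerTerm c ‖x‖) (Metric.ball 0 r) μ := by
  rw [integrableOn_fun_norm_addHaar μ (f := powerTerm c)]
  rcases le_or_gt r 0 with hr | hr
  · simp [Set.Ioo_eq_empty (not_lt.2 hr)]
  rw [← integrableOn_Ioc_iff_integrableOn_Ioo,
    ← intervalIntegrable_iff_integrableOn_Ioc_of_le hr.le]
  rcases eq_or_ne c 0 with rfl | hc₀
  · rw [powerTerm_zero_left]
    exact intervalIntegral.intervalIntegrable_log'.continuousOn_mul (by fun_prop)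
  · have hexp : -1 < ((Module.finrank ℝ E - 1 : ℕ) : ℝ) + c := by
      rw [Nat.cast_sub Module.finrank_pos, Nat.cast_one]
      linarith
    refine ((intervalIntegral.intervalIntegrable_rpow' hexp (a := 0) (b := r)).div_const c).congr ?_
    intro t ht
    rw [Set.uIoc_of_le hr.le] at ht
    simp only [powerTerm_of_ne_zero hc₀, smul_eq_mul]
    rw [Real.rpow_add ht.1, Real.rpow_natCast, mul_div_assoc]

end PowerTerm

section PowerLaw

variable {d : ℕ} {a b c : ℝ}

lemma powerLawPotential_of_ne {x : EuclideanSpace ℝ (Fin d)} (hx : x ≠ 0) :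
    powerLawPotential d a b x = ((powerTerm a ‖x‖ - powerTerm b ‖x‖ : ℝ) : EReal) :=
  if_neg fun h => hx h.1

lemma powerLawPotential_zero_of_nonpos (hb : b ≤ 0) : powerLawPotential d a b 0 = ⊤ :=
  if_pos ⟨rfl, hb⟩

lemma powerLawPotential_zero_of_pos (ha : 0 < a) (hb : 0 < b) : powerLawPotential d a b 0 = 0 := by
  simp [powerLawPotential, hb.not_ge, powerTerm_zero_right ha, powerTerm_zero_right hb]

lemma coe_le_powerLawPotential (x : EuclideanSpace ℝ (Fin d)) :
    ((powerTerm a ‖x‖ - powerTerm b ‖x‖ : ℝ) : EReal) ≤ powerLawPotential d a b x := by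
  unfold powerLawPotential
  split_ifs
  · exact le_top
  · exact le_rfl

lemma powerLawPotential_neg (x : EuclideanSpace ℝ (Fin d)) :
    powerLawPotential d a b (-x) = powerLawPotential d a b x := by
  simp [powerLawPotential]

lemma tendsto_powerLawPotential_nhdsNE_zero (ha : 0 < a) :
    Tendsto (powerLawPotential d a b) (𝓝[≠] 0) (𝓝 (powerLawPotential d a b 0)) := by
  have hnorm : Tendsto (fun x : EuclideanSpace ℝ (Fin d) => ‖x‖) (𝓝[≠] 0) (𝓝[>] 0) :=
    tendsto_norm_nhdsNE_zero
  have ha₀ := tendsto_powerTerm_nhdsGT_zero_of_pos ha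
  refine Tendsto.congr' (eventually_mem_nhdsWithin.mono fun x hx =>
    (powerLawPotential_of_ne hx).symm) ?_
  rcases le_or_gt b 0 with hb | hb
  · rw [powerLawPotential_zero_of_nonpos hb, EReal.tendsto_coe_nhds_top_iff]
    have hdiff := ha₀.add_atTop
      (tendsto_neg_atBot_atTop.comp (tendsto_powerTerm_nhdsGT_zero_of_nonpos hb))
    simpa only [sub_eq_add_neg] using! hdiff.comp hnorm
  · rw [powerLawPotential_zero_of_pos ha hb, ← EReal.coe_zero, EReal.tendsto_coe]
    simpa only [sub_zero] using! (ha₀.sub (tendsto_powerTerm_nhdsGT_zero_of_pos hb)).comp hnorm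

lemma continuous_powerLawPotential (ha : 0 < a) : Continuous (powerLawPotential d a b) := by
  refine continuous_iff_continuousAt.2 fun x => ?_
  rcases eq_or_ne x 0 with rfl | hx
  · exact continuousAt_iff_punctured_nhds.2 (tendsto_powerLawPotential_nhdsNE_zero ha)
  · have hterm (c : ℝ) : ContinuousAt (fun y => powerTerm c ‖y‖) x :=
      (continuousAt_powerTerm (.inl (norm_ne_zero_iff.2 hx))).comp continuous_norm.continuousAt
    refine (continuous_coe_real_ereal.continuousAt.comp ((hterm a).sub (hterm b))).congr ?_
    filter_upwards [isOpen_ne.mem_nhds hx] with y hy using (powerLawPotential_of_ne hy).symm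

lemma tendsto_powerLawPotential_cocompact (ha : 0 < a) (hba : b < a) :
    Tendsto (powerLawPotential d a b) (cocompact _) (𝓝 ⊤) :=
  tendsto_nhds_top_mono (EReal.tendsto_coe_nhds_top_iff.2
    ((tendsto_powerTerm_sub_powerTerm_atTop ha hba).comp
      (tendsto_norm_cocompact_atTop (E := EuclideanSpace ℝ (Fin d)))))
    (.of_forall coe_le_powerLawPotential)

lemma lintegral_abs_powerLawPotential_lt_top (hd : 1 ≤ d) (ha : -(d : ℝ) < a) (hb : -(d : ℝ) < b)
    {s : Set (EuclideanSpace ℝ (Fin d))} (hs : Bornology.IsBounded s) :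
    ∫⁻ x in s, (powerLawPotential d a b x).abs < ⊤ := by
  have : Nonempty (Fin d) := ⟨⟨0, hd⟩⟩
  rw [← finrank_euclideanSpace_fin (𝕜 := ℝ) (n := d)] at ha hb
  obtain ⟨r, hr⟩ := hs.subset_ball 0
  have hint := (integrableOn_powerTerm_norm volume ha r).sub (integrableOn_powerTerm_norm _ hb r)
  refine lt_of_le_of_lt (lintegral_mono_ae (ae_restrict_of_ae ?_)) (hint.mono_set hr).2
  filter_upwards [compl_mem_ae_iff.2 (measure_singleton 0)] with x hx
  rw [powerLawPotential_of_ne hx, EReal.abs_def, ← Real.norm_eq_abs, ofReal_norm]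
  rfl

lemma inv_sub_inv_le_powerLawPotential (ha : 0 < a) (hba : b ≤ a)
    (x : EuclideanSpace ℝ (Fin d)) : ((a⁻¹ - b⁻¹ : ℝ) : EReal) ≤ powerLawPotential d a b x := by
  rcases eq_or_ne x 0 with rfl | hx
  · rcases le_or_gt b 0 with hb | hb
    · exact powerLawPotential_zero_of_nonpos (d := d) (a := a) hb ▸ le_top
    · rw [powerLawPotential_zero_of_pos ha hb, ← EReal.coe_zero, EReal.coe_le_coe_iff, sub_nonpos]
      exact inv_anti₀ hb hba
  · rw [powerLawPotential_of_ne hx, EReal.coe_le_coe_iff]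
    have hmono := powerTerm_sub_inv_le_powerTerm_sub_inv (norm_pos_iff.2 hx) hba
    linarith

lemma basicAssumption_powerLawPotential (hd : 1 ≤ d) (ha : 0 < a) (hb : -(d : ℝ) < b)
    (hba : b ≤ a) : BasicAssumption (powerLawPotential d a b) where
  locallyIntegrable _ hK :=
    lintegral_abs_powerLawPotential_lt_top hd (hb.trans_le hba) hb hK.isBounded
  boundedBelow := ⟨_, inv_sub_inv_le_powerLawPotential ha hba⟩
  lowerSemicontinuous := (continuous_powerLawPotential ha).lowerSemicontinuous
  even := powerLawPotential_neg

lemma powerLawPotential_sub_inv_le (hc : 0 < c) (hca : c ≤ a) (x : EuclideanSpace ℝ (Fin d)) :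
    powerLawPotential d c b x - (c⁻¹ : ℝ) ≤ powerLawPotential d a b x := by
  have ha : 0 < a := hc.trans_le hca
  rcases eq_or_ne x 0 with rfl | hx
  · rcases le_or_gt b 0 with hb | hb
    · exact powerLawPotential_zero_of_nonpos (d := d) (a := a) hb ▸ le_top
    · rw [powerLawPotential_zero_of_pos hc hb, powerLawPotential_zero_of_pos ha hb]
      exact EReal.sub_nonpos.2 (EReal.coe_nonneg.2 (inv_nonneg.2 hc.le))
  · rw [powerLawPotential_of_ne hx, powerLawPotential_of_ne hx, ← EReal.coe_sub,
      EReal.coe_le_coe_iff]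
    have hmono := powerTerm_sub_inv_le_powerTerm_sub_inv (norm_pos_iff.2 hx) hca
    linarith [inv_pos.2 ha]

lemma powerLawPotential_le_of_norm_le_one (hc : 0 < c) (hca : c ≤ a)
    {x : EuclideanSpace ℝ (Fin d)} (hx : ‖x‖ ≤ 1) :
    powerLawPotential d a b x ≤ powerLawPotential d c b x := by
  unfold powerLawPotential
  split_ifs
  · exact le_rfl
  · rw [EReal.coe_le_coe_iff]
    gcongr
    exact powerTerm_le_powerTerm_of_le_one hc hca (norm_nonneg x) hx

end PowerLaw

theorem theorem2p3 (d : ℕ) (hd : 1 ≤ d) (b a₀ : ℝ) (hb : -(d : ℝ) < b) (ha₀ : max b 0 < a₀) :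
    ∃ R : ℝ, ∀ a : ℝ, a₀ ≤ a → IsUpperBoundOfMinimizerSize (powerLawPotential d a b) R := by
  obtain ⟨hba₀, hpos⟩ := max_lt_iff.1 ha₀
  obtain ⟨R, hR⟩ :=
    (basicAssumption_powerLawPotential hd hpos hb hba₀.le).exists_forall_isUpperBoundOfMinimizerSize
      (tendsto_powerLawPotential_cocompact hpos hba₀) one_pos a₀⁻¹
  refine ⟨R, fun a ha => hR _ ?_ (powerLawPotential_sub_inv_le hpos ha) fun x hx => ?_⟩
  · exact basicAssumption_powerLawPotential hd (hpos.trans_le ha) hb (hba₀.le.trans ha)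
  · exact powerLawPotential_le_of_norm_le_one hpos ha (mem_ball_zero_iff.1 hx).le
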